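/- For each prime number $p$ let $\mathbb Z_p\subset\mathbb Q_p$ denote the $p$-adic integers, and let $\widehat{\mathbb Z}=\prod_p\mathbb Z_p$ be the ring of profinite integers. For $\tau=(\tau_p)_p\in\widehat{\mathbb Z}$ put $$R_\tau=\{f\in\mathbb Q[x]\mid f(\tau_p)\in\mathbb Z_p\text{ for every prime } p\},$$ a subring of $\mathbb Q[x]$, linearly ordered by: $f<g$ if and only if $g-f$ has positive leading coefficient. A subset $S\subseteq R_\tau$ is called cofinal if for every $g\in R_\tau$ there is $s\in S$ with $g\le s$. There exists $\tau\in\widehat{\mathbb Z}$ such that $R_\tau$ is a principal ideal domain and: 1. $R_\tau$ contains a cofinal set of twin primes, i.e. the set of all positive $f\in R_\tau$ such that both $f$ and $f+2$ are prime elements of $R_\tau$ is cofinal in $R_\tau$; 2. for each integer $l\ge 1$, $R_\tau$ contains a cofinal sequence of $l$-term arithmetic progressions of primes; more precisely, there is a strictly increasing sequence $(f_n)_{n\ge 0}$ in $R_\tau$ whose set of terms is cofinal in $R_\tau$ and such that, for every $n$, all of $f_n,\ f_n+l!,\ f_n+2\cdot l!,\ \dots,\ f_n+(l-1)\cdot l!$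 are positive prime elements of $R_\tau$. -/

import Mathlib

open Polynomial
open scoped Nat

instance factPrimeOfPrimes (p : Nat.Primes) : Fact (Nat.Prime (p : ℕ)) := ⟨p.2⟩

/-- The ring of profinite integers, as the product of the rings of `p`-adic integers over all
primes `p`. -/
abbrev ProfiniteInt : Type := (p : Nat.Primes) → ℤ_[(p : ℕ)]

/-- The ring `R_τ` of all `f ∈ ℚ[x]` with `f(τ) ∈ Ẑ`: for every prime `p`, the value of `f` at
`τ_p`, computed in `ℚ_p`, lies in `ℤ_p`. -/
noncomputable def ringR (τ : ProfiniteInt) : Subring ℚ[X] where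
  carrier := {f | ∀ p : Nat.Primes,
    aeval ((τ p : ℤ_[(p : ℕ)]) : ℚ_[(p : ℕ)]) f ∈ PadicInt.subring (p : ℕ)}
  mul_mem' := fun ha hb p => by
    rw [map_mul]; exact mul_mem (ha p) (hb p)
  one_mem' := fun p => by
    rw [map_one]; exact one_mem _
  add_mem' := fun ha hb p => by
    rw [map_add]; exact add_mem (ha p) (hb p)
  zero_mem' := fun p => by
    rw [map_zero]; exact zero_mem _
  neg_mem' := fun ha p => by
    rw [map_neg]; exact neg_mem (ha p)

theorem leadingCoeff_add_pos {f g : ℚ[X]} (hf : 0 < f.leadingCoeff) (hg : 0 < g.leadingCoeff) :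
    0 < (f + g).leadingCoeff := by
  rcases lt_trichotomy f.degree g.degree with h | h | h
  · rwa [leadingCoeff_add_of_degree_lt h]
  · rw [leadingCoeff_add_of_degree_eq h (add_pos hf hg).ne']
    exact add_pos hf hg
  · rwa [leadingCoeff_add_of_degree_lt' h]

/-- The canonical linear order on `R_τ`, inherited from `ℚ[x]`: `f < g` if and only if `g - f` has
positive leading coefficient. -/
noncomputable instance ringR.linearOrder (τ : ProfiniteInt) : LinearOrder (ringR τ) where
  le f g := f = g ∨ 0 < ((g : ℚ[X]) - (f : ℚ[X])).leadingCoeff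
  lt f g := 0 < ((g : ℚ[X]) - (f : ℚ[X])).leadingCoeff
  le_refl f := Or.inl rfl
  le_trans f g h := by
    rintro (rfl | h1) (rfl | h2)
    · exact Or.inl rfl
    · exact Or.inr h2
    · exact Or.inr h1
    · right
      have := leadingCoeff_add_pos h2 h1
      rwa [sub_add_sub_cancel] at this
  le_antisymm f g := by
    rintro (rfl | h1) (h | h2)
    · rfl
    · rfl
    · exact h.symm
    · have := leadingCoeff_add_pos h2 h1
      simp at this
  lt_iff_le_not_ge f g := by
    constructor
    · intro h
      refine ⟨Or.inr h, ?_⟩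
      rintro (rfl | h2)
      · simp at h
      · have := leadingCoeff_add_pos h2 h
        simp at this
    · rintro ⟨rfl | h, h2⟩
      · exact absurd (Or.inl rfl) h2
      · exact h
  le_total f g := by
    rcases lt_trichotomy ((g : ℚ[X]) - (f : ℚ[X])).leadingCoeff 0 with h | h | h
    · right; right
      rw [← neg_sub, leadingCoeff_neg]
      exact neg_pos.mpr h
    · left; left
      rw [leadingCoeff_eq_zero, sub_eq_zero] at h
      exact Subtype.ext h.symm
    · left; right; exact h
  toDecidableLE := Classical.decRel _

/-- `f, f + c, …, f + (l - 1) c` are positive primes of the ring `R_τ`. -/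
def IsPrimeProgression (τ : ProfiniteInt) (c l : ℕ) (f : ringR τ) : Prop :=
  ∀ i < l, 0 < f + ((i * c : ℕ) : ringR τ) ∧ Prime (f + ((i * c : ℕ) : ringR τ))

/-!
An element of `R_τ` which is irreducible in `ℚ[X]` and takes a unit value at every `τ_p` is prime in
`R_τ` (`prime_of_irreducible_of_norm_eq_one`). If `τ` is generic, that is, if every nonzero rational
polynomial is nonzero at all `τ_p` and a unit at almost all of them, then `R_τ` is a principal ideal
ring (`IsGeneric.isPrincipalIdealRing`). So it suffices to find a generic `τ` and, for each `l`,
polynomials `f` of unbounded degree for which `f + i l!`, `i < l`, are irreducible with unit values;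
the twin primes are the case `l = 2`.

The polynomials are binomials `f = A X ^ D + b`. For a bound `N` given in advance, `A` is divisible
by all primes up to `N`, and `b + i l!` is prime to `A` (`exists_binomial_coeffs`). Then, at the
primes up to `N`, the values of `f + i l!` are units whatever `τ` is. Irreducibility follows from
Eisenstein's criterion for the reversed polynomial at a prime dividing `A` exactly once
(`irreducible_binomial`). For a prime `p > N` the reductions of `f + i l!` modulo `p` are nonzero and
have at most `l D` roots together. Taking `N` large compared with the degrees involved, each `τ_p`
needs to avoid fewer than `p` residue classes, for finitely many of the binomials and finitely many
terms of an enumeration of `ℤ[X]`. Within the remaining class `τ_p` is chosen transcendental, which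
is possible because algebraic numbers are countable
(`exists_profiniteInt_transcendental_avoiding`).
-/

/-! ### Irreducible binomials with prescribed coefficients -/

/-- The shifts `0, l !, …, (l - 1) l !` form an admissible tuple: modulo a prime `p ≤ l` take
`b ≡ 1`, and modulo a prime `p > l` take `b ≡ -l * l !`, so that `b + i * l !` becomes
`-(l - i) * l !` with `0 < l - i < p`. -/
theorem exists_forall_prime_not_dvd_add_mul_factorial (l N : ℕ) :
    ∃ b : ℕ, ∀ p, p.Prime → p ≤ N → ∀ i < l, ¬ p ∣ b + i * l ! := by
  set P : ℕ := ∏ p ∈ (Finset.range (N + 1)).filter (fun p => p.Prime ∧ l < p), p with hP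
  have hcop : Nat.Coprime (l !) P := by
    refine Nat.Coprime.prod_right fun p hp => ?_
    simp only [Finset.mem_filter] at hp
    exact (Nat.coprime_comm.1 (hp.2.1.coprime_iff_not_dvd.2
      (fun h => absurd (hp.2.1.dvd_factorial.1 h) (by omega))))
  -- The residue `(P - 1) * (l * l !)` stands for `-l * l !` modulo `P`.
  obtain ⟨b, hb1, hb2⟩ := Nat.chineseRemainder hcop 1 ((P - 1) * (l * l !))
  have hPpos : 0 < P := Finset.prod_pos fun p hp => by
    simp only [Finset.mem_filter] at hp
    exact hp.2.1.pos
  refine ⟨b, fun p hp hpN i hi hdvd => ?_⟩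
  rcases le_or_gt p l with hpl | hpl
  · have h1 : p ∣ l ! := hp.dvd_factorial.2 hpl
    have h2 : p ∣ b := (Nat.dvd_add_left (h1.mul_left i)).1 hdvd
    have h3 : b ≡ 1 [MOD p] := hb1.of_dvd h1
    have h4 : p ∣ 1 := (h3.dvd_iff (dvd_refl p)).1 h2
    exact hp.one_lt.ne' (Nat.dvd_one.1 h4)
  · have hpP : p ∣ P := Finset.dvd_prod_of_mem _ (Finset.mem_filter.2
      ⟨Finset.mem_range.2 (by omega), hp, hpl⟩)
    have h3 : b + l * l ! ≡ 0 [MOD p] := by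
      have := (hb2.of_dvd hpP).add_right (l * l !)
      refine this.trans ?_
      have h5 : (P - 1) * (l * l !) + l * l ! = P * (l * l !) := by
        obtain ⟨k, hk⟩ : ∃ k, P = k + 1 := ⟨P - 1, by omega⟩
        rw [hk]; simp; ring
      rw [h5]
      exact (Nat.modEq_zero_iff_dvd.2 (hpP.mul_right _))
    have h4 : p ∣ b + l * l ! := Nat.modEq_zero_iff_dvd.1 h3
    have h6 : p ∣ (l - i) * l ! := by
      have h7 : b + l * l ! = (b + i * l !) + (l - i) * l ! := by
        obtain ⟨k, hk⟩ : ∃ k, l = i + k := ⟨l - i, by omega⟩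
        have : l - i = k := by omega
        rw [this, add_assoc, ← add_mul, ← hk]
      rw [h7] at h4
      exact (Nat.dvd_add_right hdvd).1 h4
    rcases hp.dvd_mul.1 h6 with h | h
    · exact absurd (Nat.le_of_dvd (by omega) h) (by omega)
    · exact absurd (hp.dvd_factorial.1 h) (by omega)

/-- Coefficients for which the binomials `A X ^ D + (b + i * l !)`, `i < l`, are irreducible for every
`D > 0` (by the prime `q`), are nonzero modulo every prime, and reduce to nonzero constants modulo
every prime up to `N`. None of this depends on `D`. -/
theorem exists_binomial_coeffs (l N : ℕ) :
    ∃ A b q : ℕ, 0 < A ∧ (∀ p, p.Prime → p ≤ N → p ∣ A) ∧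
      (∀ p, p.Prime → p ∣ A → ∀ i < l, ¬ p ∣ b + i * l !) ∧
      q.Prime ∧ q ∣ A ∧ ¬ q ^ 2 ∣ A := by
  -- Working up to `N + 2` makes `b + i * l !` odd, hence nonzero.
  obtain ⟨b, hb⟩ := exists_forall_prime_not_dvd_add_mul_factorial l (N + 2)
  obtain ⟨q, hq, hqp⟩ := Nat.exists_infinite_primes (N + 2 + b + l * l ! + 1)
  have hqN : ¬ q ∣ (N + 2)! := fun h => absurd (hqp.dvd_factorial.1 h) (by omega)
  refine ⟨q * (N + 2)!, b, q, Nat.mul_pos hqp.pos (Nat.factorial_pos _),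
    fun p hp hpN => (hp.dvd_factorial.2 (by omega)).mul_left q, fun p hp hpA i hi hdvd => ?_, hqp,
    dvd_mul_right _ _, fun h => hqN ?_⟩
  · rcases hp.dvd_mul.1 hpA with h | h
    · obtain rfl := (Nat.prime_dvd_prime_iff_eq hp hqp).1 h
      have hpos : b + i * l ! ≠ 0 := fun h0 =>
        hb 2 Nat.prime_two (by omega) i hi (h0 ▸ dvd_zero 2)
      have h1 := Nat.le_of_dvd (Nat.pos_of_ne_zero hpos) hdvd
      have h2 : i * l ! ≤ l * l ! := Nat.mul_le_mul_right _ hi.le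
      omega
    · exact hb p hp (hp.dvd_factorial.1 h) i hi hdvd
  · rw [sq] at h
    exact Nat.dvd_of_mul_dvd_mul_left hqp.pos h

theorem irreducible_of_irreducible_reverse {K : Type*} [Field K] {f : K[X]} (h0 : f.coeff 0 ≠ 0)
    (h : Irreducible f.reverse) : Irreducible f := by
  have hdeg : ∀ g : K[X], g.coeff 0 ≠ 0 → IsUnit g.reverse → IsUnit g := by
    intro g hg hu
    have hg0 : g ≠ 0 := fun h => hg (by simp [h])
    rw [isUnit_iff_degree_eq_zero, degree_eq_natDegree hg0]
    have h1 := natDegree_eq_zero_of_isUnit hu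
    rw [reverse_natDegree, natTrailingDegree_eq_zero.2 (Or.inr hg)] at h1
    simpa using h1
  refine ⟨fun hu => h.not_isUnit ?_, fun a b hab => ?_⟩
  · rw [isUnit_iff_degree_eq_zero] at hu
    rw [eq_C_of_degree_eq_zero hu, reverse_C]
    exact isUnit_C.2 (isUnit_iff_ne_zero.2 h0)
  · rw [hab, mul_coeff_zero] at h0
    have h2 := h.isUnit_or_isUnit (by rw [hab, reverse_mul_of_domain])
    exact h2.imp (hdeg a (left_ne_zero_of_mul h0)) (hdeg b (right_ne_zero_of_mul h0))

/-- Eisenstein's criterion at `q` for the reversed polynomial `c X ^ D + A`. -/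
theorem irreducible_binomial {A c q D : ℕ} (hD : 0 < D) (hq : q.Prime) (hqA : q ∣ A)
    (hqA2 : ¬ q ^ 2 ∣ A) (hcop : A.Coprime c) :
    Irreducible (C (A : ℚ) * X ^ D + C (c : ℚ)) := by
  have hqc : ¬ q ∣ c := fun h => hq.one_lt.ne' (Nat.dvd_one.1 (hcop ▸ Nat.dvd_gcd hqA h))
  have hA : (A : ℚ) ≠ 0 := by
    rintro h; rw [Nat.cast_eq_zero] at h; exact hqA2 (h ▸ dvd_zero _)
  have hc : c ≠ 0 := fun h => hqc (h ▸ dvd_zero _)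
  have hndeg : (C (c : ℤ) * X ^ D + C (A : ℤ)).natDegree = D := by
    rw [natDegree_add_C, natDegree_C_mul_X_pow _ _ (by exact_mod_cast hc)]
  have hprim : (C (c : ℤ) * X ^ D + C (A : ℤ)).IsPrimitive := by
    intro r hr
    rw [C_dvd_iff_dvd_coeff] at hr
    have h1 := hr 0
    have h2 := hr D
    simp [coeff_X_pow, hD.ne, hD.ne'] at h1 h2
    rw [← Int.natAbs_dvd_natAbs, Int.natAbs_natCast] at h1 h2
    exact Int.isUnit_iff_natAbs_eq.2 (Nat.dvd_one.1 (hcop ▸ Nat.dvd_gcd h1 h2))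
  have hZ : Irreducible (C (c : ℤ) * X ^ D + C (A : ℤ)) := by
    refine irreducible_of_eisenstein_criterion (P := Ideal.span {(q : ℤ)}) ?_ ?_ ?_ ?_ ?_ hprim
    · rw [Ideal.span_singleton_prime (by exact_mod_cast hq.ne_zero)]
      exact Nat.prime_iff_prime_int.1 hq
    · rw [leadingCoeff, hndeg, Ideal.mem_span_singleton]
      simp [hD.ne']
      exact_mod_cast hqc
    · intro n hn
      rw [Ideal.mem_span_singleton]
      have hn' : n < D := by
        rw [← hndeg]; exact coe_lt_degree.1 hn
      rcases Nat.eq_zero_or_pos n with rfl | h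
      · simp [coeff_X_pow, hD.ne]
        exact_mod_cast hqA
      · simp [coeff_X_pow, hn'.ne, h.ne']
    · rw [← natDegree_pos_iff_degree_pos, hndeg]; exact hD
    · rw [Ideal.span_singleton_pow, Ideal.mem_span_singleton]
      simp [coeff_X_pow, hD.ne]
      exact_mod_cast hqA2
  have hQ := (IsPrimitive.Int.irreducible_iff_irreducible_map_cast hprim).1 hZ
  refine irreducible_of_irreducible_reverse (by simpa [coeff_X_pow, hD.ne] using hc) ?_
  have hrev : (C (A : ℚ) * X ^ D + C (c : ℚ)).reverse = C (c : ℚ) * X ^ D + C (A : ℚ) := by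
    rw [reverse, natDegree_add_C, natDegree_C_mul_X_pow _ _ hA, reflect_add, reflect_C_mul_X_pow,
      reflect_C, revAt_le le_rfl, Nat.sub_self, pow_zero, mul_one, add_comm]
  rw [hrev]
  simpa using hQ

/-! ### Values at `p`-adic integers -/

theorem aeval_coe_map_intCast {p : ℕ} [Fact p.Prime] (u : ℤ_[p]) (h : ℤ[X]) :
    aeval (u : ℚ_[p]) (h.map (Int.castRingHom ℚ)) = ((aeval u h : ℤ_[p]) : ℚ_[p]) := by
  have h1 := aeval_map_algebraMap ℚ (u : ℚ_[p]) h
  rw [algebraMap_int_eq] at h1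
  rw [h1]
  exact aeval_algebraMap_apply ℚ_[p] u h

theorem norm_aeval_map_intCast_le_one {p : ℕ} [Fact p.Prime] (u : ℤ_[p]) (h : ℤ[X]) :
    ‖aeval (u : ℚ_[p]) (h.map (Int.castRingHom ℚ))‖ ≤ 1 := by
  rw [aeval_coe_map_intCast]
  exact PadicInt.norm_le_one _

theorem norm_aeval_map_intCast_eq_one_iff {p : ℕ} [Fact p.Prime] (u : ℤ_[p]) (h : ℤ[X]) :
    ‖aeval (u : ℚ_[p]) (h.map (Int.castRingHom ℚ))‖ = 1 ↔
      (h.map (Int.castRingHom (ZMod p))).eval (PadicInt.toZMod u) ≠ 0 := by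
  have h2 : (h.map (Int.castRingHom (ZMod p))).eval (PadicInt.toZMod u) =
      PadicInt.toZMod (aeval u h) := by
    rw [eval_map, aeval_def, hom_eval₂]
    congr 1
    exact RingHom.ext_int _ _
  rw [aeval_coe_map_intCast, h2, ← PadicInt.norm_def, ← PadicInt.isUnit_iff, ne_eq, ← RingHom.mem_ker,
    PadicInt.ker_toZMod, IsLocalRing.mem_maximalIdeal, mem_nonunits_iff, not_not]

theorem exists_transcendental_toZMod_eq (p : ℕ) [Fact p.Prime] (a : ZMod p) :
    ∃ u : ℤ_[p], Transcendental ℚ (u : ℚ_[p]) ∧ PadicInt.toZMod u = a := by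
  have hd : Dense {x : ℚ_[p] | IsAlgebraic ℚ x}ᶜ :=
    (Algebraic.countable ℚ ℚ_[p]).dense_compl ℚ_[p]
  -- The ball of radius `1` around a lift of `a` is its residue class.
  obtain ⟨x, hx, hxa⟩ := hd.exists_mem_open (Metric.isOpen_ball (x := ((a.val : ℕ) : ℚ_[p])) (ε := 1))
    ⟨_, Metric.mem_ball_self one_pos⟩
  rw [Metric.mem_ball, dist_eq_norm] at hxa
  have hx1 : ‖x‖ ≤ 1 := by
    have := Padic.nonarchimedean (x - ((a.val : ℕ) : ℚ_[p])) ((a.val : ℕ) : ℚ_[p])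
    rw [sub_add_cancel] at this
    exact this.trans (max_le hxa.le (by exact_mod_cast Padic.norm_int_le_one (p := p) (a.val : ℤ)))
  obtain ⟨u, rfl⟩ : ∃ u : ℤ_[p], (u : ℚ_[p]) = x := ⟨⟨x, hx1⟩, rfl⟩
  refine ⟨u, hx, ?_⟩
  have h1 : u - (a.val : ℕ) ∈ RingHom.ker (PadicInt.toZMod (p := p)) := by
    rw [PadicInt.ker_toZMod, IsLocalRing.mem_maximalIdeal, PadicInt.mem_nonunits, PadicInt.norm_def]
    rw [PadicInt.coe_sub, PadicInt.coe_natCast]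
    exact hxa
  rw [RingHom.mem_ker, map_sub, map_natCast, ZMod.natCast_zmod_val, sub_eq_zero] at h1
  exact h1

/-- At a prime `p` only the `g k` with `N k < p` matter; by the degree bound their product has fewer
than `p` roots modulo `p`, so that some residue class avoids all of them. -/
theorem exists_profiniteInt_transcendental_avoiding (g : ℕ → ℤ[X]) (N : ℕ → ℕ)
    (hN : ∀ k, k ≤ N k) (hdeg : ∀ k, ∑ i ∈ Finset.range (k + 1), (g i).natDegree ≤ N k)
    (hne : ∀ k p, p.Prime → N k < p → (g k).map (Int.castRingHom (ZMod p)) ≠ 0) :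
    ∃ τ : ProfiniteInt, ∀ p : Nat.Primes,
      Transcendental ℚ ((τ p : ℤ_[(p : ℕ)]) : ℚ_[(p : ℕ)]) ∧
      ∀ k, N k < p → ((g k).map (Int.castRingHom (ZMod p))).eval (PadicInt.toZMod (τ p)) ≠ 0 := by
  suffices H : ∀ p : Nat.Primes, ∃ u : ℤ_[(p : ℕ)], Transcendental ℚ (u : ℚ_[(p : ℕ)]) ∧
      ∀ k, N k < p → ((g k).map (Int.castRingHom (ZMod p))).eval (PadicInt.toZMod u) ≠ 0 by
    choose τ hτ using H
    exact ⟨τ, hτ⟩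
  intro p
  set S : Finset ℕ := (Finset.range p).filter (fun k => N k < p) with hS
  have hlt : ∑ i ∈ S, (g i).natDegree < p := by
    rcases S.eq_empty_or_nonempty with h | h
    · rw [h]; simpa using p.2.pos
    · have h1 : N (S.max' h) < p := (Finset.mem_filter.1 (S.max'_mem h)).2
      refine lt_of_le_of_lt (le_trans ?_ (hdeg (S.max' h))) h1
      refine Finset.sum_le_sum_of_subset fun k hk => ?_
      have := S.le_max' k hk
      simp; omega
  set G : (ZMod p)[X] := ∏ i ∈ S, (g i).map (Int.castRingHom (ZMod p)) with hG
  have hG0 : G ≠ 0 := Finset.prod_ne_zero_iff.2 fun k hk =>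
    hne k p p.2 (Finset.mem_filter.1 hk).2
  have hGdeg : (G.natDegree : Cardinal) < Cardinal.mk (ZMod p) := by
    rw [Cardinal.mk_fintype, ZMod.card]
    have : G.natDegree ≤ ∑ i ∈ S, (g i).natDegree :=
      (natDegree_prod_le _ _).trans (Finset.sum_le_sum fun i _ => natDegree_map_le)
    exact_mod_cast this.trans_lt hlt
  obtain ⟨a, ha⟩ := exists_eval_ne_zero_of_natDegree_lt_card G hG0 hGdeg
  obtain ⟨u, hu, hua⟩ := exists_transcendental_toZMod_eq p a
  refine ⟨u, hu, fun k hk => ?_⟩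
  rw [hG, eval_prod, Finset.prod_ne_zero_iff] at ha
  rw [hua]
  exact ha k (Finset.mem_filter.2 ⟨Finset.mem_range.2 ((hN k).trans_lt hk), hk⟩)

/-! ### Divisibility in `R_τ` -/

/-- Evaluation of rational polynomials at the `p`-component of `τ`. -/
noncomputable def evalAt (τ : ProfiniteInt) (p : Nat.Primes) : ℚ[X] →ₐ[ℚ] ℚ_[(p : ℕ)] :=
  aeval ((τ p : ℤ_[(p : ℕ)]) : ℚ_[(p : ℕ)])

theorem mem_ringR_iff {τ : ProfiniteInt} {f : ℚ[X]} :
    f ∈ ringR τ ↔ ∀ p, ‖evalAt τ p f‖ ≤ 1 := Iff.rfl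

theorem evalAt_C (τ : ProfiniteInt) (p : Nat.Primes) (q : ℚ) :
    evalAt τ p (C q) = (q : ℚ_[(p : ℕ)]) := by
  rw [evalAt, aeval_C, eq_ratCast]

theorem map_intCast_mem_ringR (τ : ProfiniteInt) (h : ℤ[X]) :
    h.map (Int.castRingHom ℚ) ∈ ringR τ :=
  mem_ringR_iff.2 fun p => norm_aeval_map_intCast_le_one (τ p) h

theorem exists_map_intCast_eq_C_mul (f : ℚ[X]) :
    ∃ (c : ℤ) (h : ℤ[X]), c ≠ 0 ∧ h.map (Int.castRingHom ℚ) = C (c : ℚ) * f := by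
  obtain ⟨c, hc, h⟩ := IsLocalization.integerNormalization_spec (nonZeroDivisors ℤ) f
  refine ⟨c, IsLocalization.integerNormalization (nonZeroDivisors ℤ) f,
    nonZeroDivisors.ne_zero hc, ?_⟩
  rw [algebraMap_int_eq] at h
  rw [h, ← Int.cast_smul_eq_zsmul ℚ, smul_eq_C_mul]

theorem ringR_dvd_of_dvd {τ : ProfiniteInt} {f g : ringR τ} (hf : ∀ p, ‖evalAt τ p f‖ = 1)
    (h : (f : ℚ[X]) ∣ g) : f ∣ g := by
  obtain ⟨k, hk⟩ := h
  refine ⟨⟨k, mem_ringR_iff.2 fun p => ?_⟩, Subtype.ext hk⟩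
  have := mem_ringR_iff.1 g.2 p
  rwa [hk, map_mul, norm_mul, hf, one_mul] at this

/-- Since `f` has unit values, a quotient by `f` in `ℚ[X]` of an element of `R_τ` is again in
`R_τ`. Hence primality descends from `ℚ[X]`. -/
theorem prime_of_irreducible_of_norm_eq_one {τ : ProfiniteInt} {f : ringR τ}
    (hirr : Irreducible (f : ℚ[X])) (hf : ∀ p, ‖evalAt τ p f‖ = 1) : Prime f := by
  refine ⟨fun h => hirr.ne_zero (by rw [h]; rfl),
    fun h => hirr.not_isUnit (h.map (ringR τ).subtype), fun a b hab => ?_⟩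
  have h1 : (f : ℚ[X]) ∣ (a : ℚ[X]) * b := by
    obtain ⟨k, hk⟩ := hab
    exact ⟨k, by rw [← Subring.coe_mul, hk, Subring.coe_mul]⟩
  exact (hirr.prime.dvd_or_dvd h1).imp (ringR_dvd_of_dvd hf) (ringR_dvd_of_dvd hf)

theorem norm_primeCast_of_ne {p r : Nat.Primes} (h : r ≠ p) :
    ‖((p : ℕ) : ℚ_[(r : ℕ)])‖ = 1 :=
  Padic.norm_natCast_eq_one_iff.2 ((Nat.coprime_primes r.2 p.2).2 fun h1 => h (Subtype.ext h1))

/-- The residue ring `R_τ / p` is `𝔽_p`: an element whose value at `τ_p` is divisible by `p` is `p`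
times an element of `R_τ`. -/
theorem exists_eq_natCast_add_prime_mul (τ : ProfiniteInt) (p : Nat.Primes) (k : ringR τ) :
    ∃ (a : ℕ) (k' : ringR τ), k = a + (p : ℕ) * k' := by
  obtain ⟨u, hu⟩ : ∃ u : ℤ_[(p : ℕ)], (u : ℚ_[(p : ℕ)]) = evalAt τ p k :=
    ⟨⟨_, mem_ringR_iff.1 k.2 p⟩, rfl⟩
  have hp0 : ((p : ℕ) : ℚ) ≠ 0 := by exact_mod_cast p.2.ne_zero
  set a := u.zmodRepr
  have hmem : C (((p : ℕ) : ℚ)⁻¹) * ((k : ℚ[X]) - (a : ℚ[X])) ∈ ringR τ := by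
    refine mem_ringR_iff.2 fun r => ?_
    rw [map_mul, norm_mul, evalAt_C, Rat.cast_inv, Rat.cast_natCast, norm_inv]
    by_cases h : r = p
    · subst h
      rw [Padic.norm_p, inv_inv, map_sub, map_natCast, ← hu, ← PadicInt.coe_natCast,
        ← PadicInt.coe_sub, ← PadicInt.norm_def]
      have h1 := PadicInt.norm_sub_zmodRepr_lt_one u
      obtain ⟨v, hv⟩ := (PadicInt.norm_lt_one_iff_dvd _).1 h1
      rw [hv, norm_mul, PadicInt.norm_p, ← mul_assoc,
        mul_inv_cancel₀ (by exact_mod_cast r.2.ne_zero), one_mul]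
      exact PadicInt.norm_le_one v
    · rw [norm_primeCast_of_ne h, inv_one, one_mul]
      exact mem_ringR_iff.1 (sub_mem k.2 (natCast_mem _ a)) r
  refine ⟨a, ⟨_, hmem⟩, Subtype.ext ?_⟩
  have h2 : (((p : ℕ) : ℚ[X])) * (C (((p : ℕ) : ℚ)⁻¹) * ((k : ℚ[X]) - (a : ℚ[X]))) =
      (k : ℚ[X]) - (a : ℚ[X]) := by
    rw [← mul_assoc, ← C_eq_natCast, ← C_mul, mul_inv_cancel₀ hp0, C_1, one_mul]
  push_cast
  rw [h2]; ring

theorem exists_eq_natCast_add_mul (τ : ProfiniteInt) {n : ℕ} (hn : n ≠ 0) :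
    ∀ k : ringR τ, ∃ (a : ℕ) (k' : ringR τ), k = a + n * k' := by
  induction n using induction_on_primes with
  | zero => exact absurd rfl hn
  | one => exact fun k => ⟨0, k, by simp⟩
  | prime_mul p m hp ih =>
    intro k
    obtain ⟨a, k1, h1⟩ := exists_eq_natCast_add_prime_mul τ ⟨p, hp⟩ k
    obtain ⟨b, k2, h2⟩ := ih (right_ne_zero_of_mul hn) k1
    refine ⟨a + p * b, k2, ?_⟩
    rw [h1, h2]
    push_cast
    ring

theorem exists_eq_intCast_add_mul (τ : ProfiniteInt) {d : ℤ} (hd : d ≠ 0) (k : ringR τ) :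
    ∃ (a : ℤ) (k' : ringR τ), k = a + d * k' := by
  obtain ⟨n, rfl | rfl⟩ := d.eq_nat_or_neg
  · obtain ⟨a, k', h⟩ := exists_eq_natCast_add_mul τ (Int.natCast_ne_zero.1 hd) k
    exact ⟨a, k', by rw [h]; push_cast; rfl⟩
  · obtain ⟨a, k', h⟩ :=
      exists_eq_natCast_add_mul τ (Int.natCast_ne_zero.1 (neg_ne_zero.1 hd)) k
    exact ⟨a, -k', by rw [h]; push_cast; ring⟩

/-! ### The principal ideal property -/

/-- `τ` is generic if every nonzero rational polynomial has nonzero value at every component of `τ`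
and a unit value at all but finitely many components. -/
def IsGeneric (τ : ProfiniteInt) : Prop :=
  ∀ f : ℚ[X], f ≠ 0 → (∀ p, evalAt τ p f ≠ 0) ∧ {p | ‖evalAt τ p f‖ ≠ 1}.Finite

/-- Multiplying by powers of the finitely many primes in `s` makes all values of `f` units. -/
theorem exists_C_mul_norm_eq_one {τ : ProfiniteInt} (s : Finset Nat.Primes) :
    ∀ f : ℚ[X], (∀ p, evalAt τ p f ≠ 0) → (∀ p, p ∉ s → ‖evalAt τ p f‖ = 1) →
      ∃ q : ℚ, q ≠ 0 ∧ ∀ p, ‖evalAt τ p (C q * f)‖ = 1 := by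
  induction s using Finset.induction_on with
  | empty => exact fun f _ h => ⟨1, one_ne_zero, fun p => by simpa using h p (by simp)⟩
  | insert p s _ ih =>
    intro f h0 h1
    have hp0 : ((p : ℕ) : ℚ) ≠ 0 := by exact_mod_cast p.2.ne_zero
    set v := (evalAt τ p f).valuation
    have hnorm : ∀ r, ‖evalAt τ r (C (((p : ℕ) : ℚ) ^ (-v)) * f)‖ =
        ‖((p : ℕ) : ℚ_[(r : ℕ)])‖ ^ (-v) * ‖evalAt τ r f‖ := fun r => by
      rw [map_mul, norm_mul, evalAt_C, Rat.cast_zpow, Rat.cast_natCast, norm_zpow]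
    obtain ⟨q, hq, hq1⟩ := ih (C (((p : ℕ) : ℚ) ^ (-v)) * f) (fun r => norm_ne_zero_iff.1 (by
      rw [hnorm]
      exact mul_ne_zero (zpow_ne_zero _ (norm_ne_zero_iff.2 (by exact_mod_cast p.2.ne_zero)))
        (norm_ne_zero_iff.2 (h0 r)))) (fun r hr => by
      rw [hnorm]
      by_cases h : r = p
      · subst h
        rw [Padic.norm_p, Padic.norm_eq_zpow_neg_valuation (h0 r), inv_zpow, ← zpow_neg,
          ← zpow_add₀ (by exact_mod_cast r.2.ne_zero)]
        simp [v]
      · rw [norm_primeCast_of_ne h, one_zpow, one_mul]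
        exact h1 r (by simp [h, hr]))
    refine ⟨q * ((p : ℕ) : ℚ) ^ (-v), mul_ne_zero hq (zpow_ne_zero _ hp0), fun r => ?_⟩
    rw [C_mul, mul_assoc]
    exact hq1 r

/-- An ideal `I` generates a principal ideal `(g)` of `ℚ[X]`, where `g` may be scaled to have unit
values; then `I = g * J` for an ideal `J` of `R_τ` that contains a nonzero integer. As every residue
ring `R_τ / d` is a quotient of `ℤ`, the ideal `J` is generated by its integers, hence by one of
them. -/
theorem IsGeneric.isPrincipalIdealRing {τ : ProfiniteInt} (hτ : IsGeneric τ) :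
    IsPrincipalIdealRing (ringR τ) := by
  refine ⟨fun I => ?_⟩
  by_cases hI : I = ⊥
  · rw [hI]; exact bot_isPrincipal
  obtain ⟨f0, hf0I, hf0⟩ := Submodule.exists_mem_ne_zero_of_ne_bot hI
  obtain ⟨g0, hg0⟩ := (IsPrincipalIdealRing.principal (I.map (ringR τ).subtype)).principal
  have hdvd0 : ∀ f ∈ I, g0 ∣ (f : ℚ[X]) := fun f hf => by
    have : (ringR τ).subtype f ∈ I.map (ringR τ).subtype := Ideal.mem_map_of_mem _ hf
    rw [hg0] at this
    exact Ideal.mem_span_singleton.1 this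
  have hg0ne : g0 ≠ 0 := by
    rintro rfl
    exact hf0 (Subtype.ext (zero_dvd_iff.1 (hdvd0 f0 hf0I)))
  obtain ⟨hne, hfin⟩ := hτ g0 hg0ne
  obtain ⟨q, hq, hq1⟩ := exists_C_mul_norm_eq_one hfin.toFinset g0 hne (by simp)
  obtain ⟨g, hg⟩ : ∃ g : ringR τ, (g : ℚ[X]) = C q * g0 :=
    ⟨⟨_, mem_ringR_iff.2 fun p => (hq1 p).le⟩, rfl⟩
  have hdvd : ∀ f ∈ I, g ∣ f := fun f hf => by
    refine ringR_dvd_of_dvd (by rwa [hg]) ?_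
    rw [hg]
    exact (IsUnit.mul_left_dvd (isUnit_C.2 hq.isUnit)).2 (hdvd0 f hf)
  -- Clearing denominators brings the ideal generated by `I` in `ℚ[X]` back into `I`.
  have hmult : ∀ x ∈ I.map (ringR τ).subtype,
      ∃ c : ℤ, c ≠ 0 ∧ ∃ y ∈ I, (y : ℚ[X]) = (c : ℚ[X]) * x := by
    intro x hx
    induction hx using Submodule.span_induction with
    | mem x hx =>
      obtain ⟨y, hy, rfl⟩ := hx
      exact ⟨1, one_ne_zero, y, hy, by simp⟩
    | zero => exact ⟨1, one_ne_zero, 0, I.zero_mem, by simp⟩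
    | add x x' _ _ h h' =>
      obtain ⟨c, hc, y, hy, h⟩ := h
      obtain ⟨c', hc', y', hy', h'⟩ := h'
      refine ⟨c * c', mul_ne_zero hc hc', (c' : ringR τ) * y + (c : ringR τ) * y',
        I.add_mem (I.mul_mem_left _ hy) (I.mul_mem_left _ hy'), ?_⟩
      push_cast
      rw [h, h']; ring
    | smul a x _ h =>
      obtain ⟨c, hc, y, hy, h⟩ := h
      obtain ⟨m, k, hm, hk⟩ := exists_map_intCast_eq_C_mul a
      refine ⟨m * c, mul_ne_zero hm hc, ⟨_, map_intCast_mem_ringR τ k⟩ * y,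
        I.mul_mem_left _ hy, ?_⟩
      have hm' : C (m : ℚ) = (m : ℚ[X]) := by simp
      change k.map (Int.castRingHom ℚ) * (y : ℚ[X]) = _
      rw [h, hk, smul_eq_mul, hm']
      push_cast; ring
  -- The integers of the ideal `J` with `I = g * J`.
  set K : Ideal ℤ := (I.colon {g}).comap (Int.castRingHom (ringR τ)) with hK
  have hmemK : ∀ a : ℤ, a ∈ K ↔ (a : ringR τ) * g ∈ I := fun a => by
    rw [hK, Ideal.mem_comap, Submodule.mem_colon_singleton]; rfl
  obtain ⟨d, hd⟩ := (IsPrincipalIdealRing.principal K).principal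
  have hdI : (d : ringR τ) * g ∈ I :=
    (hmemK d).1 (by rw [hd]; exact Ideal.mem_span_singleton_self d)
  have hd0 : d ≠ 0 := by
    rintro rfl
    obtain ⟨c, hc, y, hy, h⟩ := hmult (C q * g0)
      (by rw [hg0]; exact Ideal.mul_mem_left _ _ (Ideal.mem_span_singleton_self g0))
    have : c ∈ K := (hmemK c).2 (by
      convert hy
      refine Subtype.ext ?_
      rw [h, ← hg]; push_cast; rfl)
    rw [hd] at this
    exact hc (by simpa using this)
  refine ⟨(d : ringR τ) * g, le_antisymm (fun f hf => ?_) ?_⟩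
  · obtain ⟨k, rfl⟩ := hdvd f hf
    obtain ⟨a, k', rfl⟩ := exists_eq_intCast_add_mul τ hd0 k
    have ha : a ∈ K := (hmemK a).2 (by
      have : (a : ringR τ) * g = g * (a + d * k') - k' * (d * g) := by ring
      rw [this]
      exact I.sub_mem hf (I.mul_mem_left _ hdI))
    rw [hd] at ha
    obtain ⟨e, rfl⟩ := Ideal.mem_span_singleton.1 ha
    exact Ideal.mem_span_singleton.2 ⟨e + k', by push_cast; ring⟩
  · exact (Ideal.span_singleton_le_iff_mem I).2 hdI

theorem isGeneric_of_transcendental {τ : ProfiniteInt}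
    (h0 : ∀ p : Nat.Primes, Transcendental ℚ ((τ p : ℤ_[(p : ℕ)]) : ℚ_[(p : ℕ)]))
    (h1 : ∀ h : ℤ[X], h ≠ 0 → ∃ M : ℕ, ∀ p : Nat.Primes, M < p →
      ‖evalAt τ p (h.map (Int.castRingHom ℚ))‖ = 1) : IsGeneric τ := by
  intro f hf
  refine ⟨fun p h => hf (transcendental_iff.1 (h0 p) f h), ?_⟩
  obtain ⟨c, h, hc, hh⟩ := exists_map_intCast_eq_C_mul f
  have hh0 : h ≠ 0 := by
    rintro rfl
    rw [Polynomial.map_zero, eq_comm, mul_eq_zero, C_eq_zero, Int.cast_eq_zero] at hh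
    exact hh.elim hc hf
  obtain ⟨M, hM⟩ := h1 h hh0
  refine Set.Finite.subset (Set.Finite.preimage (f := fun p : Nat.Primes => (p : ℕ))
    Subtype.val_injective.injOn (Set.finite_Iic (max M c.natAbs))) fun p hp => ?_
  rw [Set.mem_preimage, Set.mem_Iic]
  by_contra! hlt
  refine hp ?_
  have h2 := hM p ((le_max_left _ _).trans_lt hlt)
  have h3 : ‖(c : ℚ_[(p : ℕ)])‖ = 1 := by
    refine le_antisymm (Padic.norm_int_le_one c) (not_lt.1 fun h => ?_)
    rw [Padic.norm_intCast_lt_one_iff, Int.natCast_dvd] at h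
    exact absurd (Nat.le_of_dvd (Int.natAbs_pos.2 hc) h)
      (not_le.2 ((le_max_right _ _).trans_lt hlt))
  rwa [hh, map_mul, norm_mul, evalAt_C, Rat.cast_intCast, h3, one_mul] at h2

/-! ### The order of `R_τ` and binomials -/

theorem ringR_lt_of_degree_lt {τ : ProfiniteInt} {f g : ringR τ}
    (h : (f : ℚ[X]).degree < (g : ℚ[X]).degree) (hg : 0 < (g : ℚ[X]).leadingCoeff) : f < g := by
  change 0 < ((g : ℚ[X]) - (f : ℚ[X])).leadingCoeff
  rwa [leadingCoeff_sub_of_degree_lt h]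

/-- The integral binomial `A X ^ D + c`. -/
noncomputable def binomialPoly (A D c : ℕ) : ℤ[X] := C (A : ℤ) * X ^ D + C (c : ℤ)

theorem map_binomial {R : Type*} [CommRing R] (A D c : ℕ) :
    (binomialPoly A D c).map (Int.castRingHom R) = C (A : R) * X ^ D + C (c : R) := by
  simp [binomialPoly]

theorem natDegree_binomial_le (A D c : ℕ) : (binomialPoly A D c).natDegree ≤ D := by
  rw [binomialPoly, natDegree_add_C]
  exact natDegree_C_mul_X_pow_le _ _

theorem degree_map_binomial {A D : ℕ} (hA : A ≠ 0) (hD : D ≠ 0) (c : ℕ) :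
    ((binomialPoly A D c).map (Int.castRingHom ℚ)).degree = D := by
  have hA' : (A : ℚ) ≠ 0 := by exact_mod_cast hA
  rw [map_binomial, degree_add_C, degree_C_mul_X_pow _ hA']
  rw [degree_C_mul_X_pow _ hA']
  exact_mod_cast Nat.pos_of_ne_zero hD

theorem leadingCoeff_map_binomial {A D : ℕ} (hA : A ≠ 0) (hD : D ≠ 0) (c : ℕ) :
    ((binomialPoly A D c).map (Int.castRingHom ℚ)).leadingCoeff = A := by
  rw [leadingCoeff, natDegree_eq_of_degree_eq_some (degree_map_binomial hA hD c), map_binomial]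
  simp [hD]

theorem map_binomial_zmod_ne_zero {A D c p : ℕ} (hD : D ≠ 0) (h : p ∣ A → ¬ p ∣ c) :
    (binomialPoly A D c).map (Int.castRingHom (ZMod p)) ≠ 0 := by
  intro h0
  rw [map_binomial] at h0
  have h1 := congrArg (fun f => coeff f D) h0
  have h2 := congrArg (fun f => coeff f 0) h0
  simp [hD, coeff_X_pow, hD.symm] at h1 h2
  exact h ((ZMod.natCast_eq_zero_iff _ _).1 h1) ((ZMod.natCast_eq_zero_iff _ _).1 h2)

theorem map_intCast_zmod_ne_zero {h : ℤ[X]} (hh : h ≠ 0) {p : ℕ}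
    (hp : h.leadingCoeff.natAbs < p) : h.map (Int.castRingHom (ZMod p)) ≠ 0 := by
  intro h0
  have h1 := congrArg (fun f => coeff f h.natDegree) h0
  simp only [coeff_map, coeff_natDegree, eq_intCast, coeff_zero] at h1
  rw [ZMod.intCast_zmod_eq_zero_iff_dvd, Int.natCast_dvd] at h1
  exact absurd (Nat.le_of_dvd (Int.natAbs_pos.2 (leadingCoeff_ne_zero.2 hh)) h1) (not_le.2 hp)

/-! ### Construction of `τ` -/

/-- The index `k` encodes a pair `(l - 1, n)`, where `l = (Nat.unpair k).1 + 1`; the `k`-th binomial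
has degree `k + 1` and serves for progressions of length `l`. The threshold `N k` depends only on
the degrees, known in advance, and on the enumerated polynomials `h i`. The primes up to `N k` divide
`A k`, so that they impose no condition on `τ`; at larger primes `τ` is chosen to avoid the roots of
the binomials and of `h k`. -/
theorem exists_isGeneric_binomials :
    ∃ (τ : ProfiniteInt) (A b : ℕ → ℕ), IsGeneric τ ∧ (∀ k, A k ≠ 0) ∧
      ∀ k, ∀ i < (Nat.unpair k).1 + 1,
        Irreducible ((binomialPoly (A k) (k + 1)
          (b k + i * ((Nat.unpair k).1 + 1)!)).map (Int.castRingHom ℚ)) ∧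
        ∀ p, ‖evalAt τ p ((binomialPoly (A k) (k + 1)
          (b k + i * ((Nat.unpair k).1 + 1)!)).map (Int.castRingHom ℚ))‖ = 1 := by
  set l : ℕ → ℕ := fun k => (Nat.unpair k).1 + 1 with hl
  have hlk : ∀ k, l k ≤ k + 1 := fun k => Nat.succ_le_succ (Nat.unpair_left_le k)
  have : Countable ℤ[X] := by
    rw [← Cardinal.mk_le_aleph0_iff]
    exact (cardinalMk_le_max (R := ℤ)).trans (by simp)
  have : Nonempty {h : ℤ[X] // h ≠ 0} := ⟨⟨1, one_ne_zero⟩⟩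
  -- An enumeration of all nonzero integer polynomials, for genericity.
  obtain ⟨h, hsurj⟩ := exists_surjective_nat {h : ℤ[X] // h ≠ 0}
  -- The first two terms bound the degree of `h i` times the binomials of index `i`; the last one
  -- makes the reduction of `h i` modulo every larger prime nonzero.
  set w : ℕ → ℕ := fun i =>
    (h i).1.natDegree + (i + 1) * (i + 1) + (h i).1.leadingCoeff.natAbs with hw
  set N : ℕ → ℕ := fun k => ∑ i ∈ Finset.range (k + 1), w i + k with hN
  have hwN : ∀ k, w k ≤ N k := fun k =>
    (Finset.single_le_sum (f := w) (fun _ _ => Nat.zero_le _)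
      (Finset.self_mem_range_succ k)).trans (Nat.le_add_right _ _)
  choose A b q hA hAN hAb hq hqA hqA2 using fun k => exists_binomial_coeffs (l k) (N k)
  set B : ℕ → ℕ → ℤ[X] := fun k i => binomialPoly (A k) (k + 1) (b k + i * (l k)!) with hB
  have hdegB : ∀ k, (∏ i ∈ Finset.range (l k), B k i).natDegree ≤ (k + 1) * (k + 1) := fun k => by
    refine (natDegree_prod_le _ _).trans ?_
    refine (Finset.sum_le_card_nsmul _ _ (k + 1) fun i _ => natDegree_binomial_le _ _ _).trans ?_
    rw [Finset.card_range, smul_eq_mul]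
    exact Nat.mul_le_mul_right _ (hlk k)
  obtain ⟨τ, hτ⟩ := exists_profiniteInt_transcendental_avoiding
    (fun k => (h k).1 * ∏ i ∈ Finset.range (l k), B k i) N (fun k => Nat.le_add_left _ _)
    (fun k => by
      refine (Finset.sum_le_sum fun i _ => ?_).trans (Nat.le_add_right _ _)
      refine natDegree_mul_le.trans ((add_le_add le_rfl (hdegB i)).trans (Nat.le_add_right _ _)))
    (fun k p hp hkp => by
      have := Fact.mk hp
      rw [Polynomial.map_mul, Polynomial.map_prod]
      refine mul_ne_zero (map_intCast_zmod_ne_zero (h k).2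
        (lt_of_le_of_lt ((Nat.le_add_left _ _).trans (hwN k)) hkp))
        (Finset.prod_ne_zero_iff.2 fun i hi => ?_)
      exact map_binomial_zmod_ne_zero k.succ_ne_zero fun h => hAb k p hp h i (Finset.mem_range.1 hi))
  have hval : ∀ k (p : Nat.Primes), N k < p →
      ‖evalAt τ p ((h k).1.map (Int.castRingHom ℚ))‖ = 1 ∧
      ∀ i < l k, ‖evalAt τ p ((B k i).map (Int.castRingHom ℚ))‖ = 1 := fun k p hkp => by
    have h1 := (hτ p).2 k hkp
    rw [Polynomial.map_mul, Polynomial.map_prod, eval_mul, eval_prod] at h1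
    exact ⟨(norm_aeval_map_intCast_eq_one_iff _ _).2 (left_ne_zero_of_mul h1), fun i hi =>
      (norm_aeval_map_intCast_eq_one_iff _ _).2
        (Finset.prod_ne_zero_iff.1 (right_ne_zero_of_mul h1) i (Finset.mem_range.2 hi))⟩
  refine ⟨τ, A, b, isGeneric_of_transcendental (fun p => (hτ p).1) fun f hf => ?_,
    fun k => (hA k).ne', fun k i hi => ⟨?_, fun p => ?_⟩⟩
  · obtain ⟨k, hk⟩ := hsurj ⟨f, hf⟩
    exact ⟨N k, fun p hp => by simpa [hk] using (hval k p hp).1⟩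
  · rw [map_binomial]
    exact irreducible_binomial k.succ_pos (hq k) (hqA k) (hqA2 k)
      (Nat.Coprime.symm (Nat.coprime_of_dvd fun p hp h1 h2 => hAb k p hp h2 i hi h1))
  · rcases lt_or_ge (N k) p with hp | hp
    · exact (hval k p hp).2 i hi
    · refine (norm_aeval_map_intCast_eq_one_iff _ _).2 ?_
      have h1 : ((A k : ℕ) : ZMod p) = 0 := (ZMod.natCast_eq_zero_iff _ _).2 (hAN k p p.2 hp)
      rw [map_binomial, h1, C_0, zero_mul, zero_add, eval_C, ne_eq, ZMod.natCast_eq_zero_iff]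
      exact hAb k p p.2 (hAN k p p.2 hp) i hi

theorem corollary4p4 :
    ∃ τ : ProfiniteInt,
      IsDomain (ringR τ) ∧ IsPrincipalIdealRing (ringR τ) ∧
      IsCofinal {f : ringR τ | 0 < f ∧ Prime f ∧ Prime (f + 2)} ∧
      ∀ l : ℕ, 1 ≤ l →
        ∃ f : ℕ → ringR τ, StrictMono f ∧ IsCofinal (Set.range f) ∧
          ∀ n : ℕ, IsPrimeProgression τ (l !) l (f n) := by
  obtain ⟨τ, A, b, hτ, hA, hAb⟩ := exists_isGeneric_binomials
  have key : ∀ l : ℕ, 1 ≤ l →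
      ∃ f : ℕ → ringR τ, StrictMono f ∧ IsCofinal (Set.range f) ∧
        ∀ n : ℕ, IsPrimeProgression τ (l !) l (f n) := by
    intro l hl
    obtain ⟨m, rfl⟩ : ∃ m, l = m + 1 := ⟨l - 1, by omega⟩
    have hmono : StrictMono (Nat.pair m) := fun _ _ h => Nat.pair_lt_pair_right m h
    let f : ℕ → ringR τ := fun n =>
      ⟨_, map_intCast_mem_ringR τ (binomialPoly (A (Nat.pair m n)) (Nat.pair m n + 1) (b (Nat.pair m n)))⟩
    have hdeg : ∀ n, (f n : ℚ[X]).degree = (Nat.pair m n + 1 : ℕ) := fun n =>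
      degree_map_binomial (hA _) (Nat.succ_ne_zero _) _
    have hlead : ∀ k c : ℕ,
        0 < ((binomialPoly (A k) (k + 1) c).map (Int.castRingHom ℚ)).leadingCoeff := fun k c => by
      rw [leadingCoeff_map_binomial (hA k) k.succ_ne_zero]
      exact_mod_cast Nat.pos_of_ne_zero (hA k)
    refine ⟨f, fun i j hij => ringR_lt_of_degree_lt ?_ (hlead _ _), fun g => ?_, fun n i hi => ?_⟩
    · rw [hdeg, hdeg]
      exact_mod_cast Nat.succ_lt_succ (hmono hij)
    · refine ⟨_, ⟨(g : ℚ[X]).natDegree, rfl⟩, (ringR_lt_of_degree_lt ?_ (hlead _ _)).le⟩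
      rw [hdeg]
      refine degree_le_natDegree.trans_lt ?_
      exact_mod_cast Nat.lt_succ_of_le (Nat.right_le_pair _ _)
    · have hcoe : ((f n + ((i * (m + 1)! : ℕ) : ringR τ) : ringR τ) : ℚ[X]) =
          (binomialPoly (A (Nat.pair m n)) (Nat.pair m n + 1)
            (b (Nat.pair m n) + i * (m + 1)!)).map (Int.castRingHom ℚ) := by
        have : (f n : ℚ[X]) = (binomialPoly (A (Nat.pair m n)) (Nat.pair m n + 1)
          (b (Nat.pair m n))).map (Int.castRingHom ℚ) := rfl
        rw [Subring.coe_add, this, map_binomial, map_binomial, Subring.coe_natCast, Nat.cast_add,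
          C_add, add_assoc, C_eq_natCast, C_eq_natCast, C_eq_natCast]
      have h1 := hAb (Nat.pair m n) i
      rw [Nat.unpair_pair] at h1
      obtain ⟨hirr, hnorm⟩ := h1 hi
      refine ⟨ringR_lt_of_degree_lt ?_ (by rw [hcoe]; exact hlead _ _),
        prime_of_irreducible_of_norm_eq_one (by rwa [hcoe]) (by rwa [hcoe])⟩
      rw [hcoe, degree_map_binomial (hA _) (Nat.succ_ne_zero _)]
      simp
  refine ⟨τ, inferInstance, hτ.isPrincipalIdealRing, fun g => ?_, key⟩
  -- A progression of length `2` has common difference `2 ! = 2`.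
  obtain ⟨f, -, hcof, hf⟩ := key 2 (by norm_num)
  obtain ⟨_, ⟨n, rfl⟩, hn⟩ := hcof g
  have h0 := hf n 0 (by norm_num)
  have h1 := hf n 1 (by norm_num)
  simp only [zero_mul, one_mul, Nat.cast_zero, add_zero, Nat.factorial_two, Nat.cast_ofNat] at h0 h1
  exact ⟨f n, ⟨h0.1, h0.2, h1.2⟩, hn⟩
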